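/- **Setting.** Let $\overline R\to R\to S$ be surjective ring maps between coherent commutative rings with finitely generated kernels; put $I=\ker(\overline R\to S)$, $J=\ker(\overline R\to R)$ and assume $IJ=0$ (so $J^2=0$ and $J$ is an $S$-module). For a coherent commutative ring $A$, an object $Y$ of an $A$-linear abelian category is *coflat* if $\mathrm{Hom}_A(-,Y)$ is exact on finitely presented $A$-modules, where $\mathrm{Hom}_A(M,Y)$ is the object representing $X\mapsto \mathrm{Hom}_A(M,\mathrm{Hom}(X,Y))$; an $A$-linear abelian category with enough injectives is *flat* if its injectives are coflat. For a surjection $A\to B$ of commutative rings, an *abelian deformation* along $A\to B$ of a $B$-linear abelian category $\mathcal D$ is an $A$-linear functor $\mathcal D\to\mathcal E$ to an $A$-linear abelian category inducing an equivalence of $\mathcal D$ with the full subcategory of those objects of $\mathcal E$ that have a $B$-structure extending the $A$-structure. Let $\mathcal C_0$, $\mathcal C$, $\overline{\mathcal C}$ be flat abelian categories with enough injectives, linear over $S$, $R$, $\overline R$ respectively, and let $\mathcal C_0\to\mathcal C\to\overline{\mathcal C}$ be abelian deformations along $R\to S$ and $\overline R\to R$. Let $\mathrm{Hom}_R(S,-):\mathcal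 C\to\mathcal C_0$ and $\mathrm{Hom}_{\overline R}(R,-):\overline{\mathcal C}\to\mathcal C$ be their right adjoints. The objects $\mathrm{Hom}_R(J,Y)$ lie in $\mathcal C_0$, which gives a functor $\mathrm{Hom}_R(J,-):\mathcal C\to\mathcal C_0$. Let $R\mathrm{Hom}_R(S,-),\,R\mathrm{Hom}_R(J,-):D^+(\mathcal C)\to D^+(\mathcal C_0)$ and $F=R\mathrm{Hom}_{\overline R}(R,-):D^+(\overline{\mathcal C})\to D^+(\mathcal C)$ be the right derived functors. A lift of an object $C^\cdot$ of $D^+(\mathcal C)$ along $F$ is an object $\overline C^\cdot$ of $D^+(\overline{\mathcal C})$ with an isomorphism $c:C^\cdot\cong F(\overline C^\cdot)$. Given lifts $(\overline C^\cdot,c)$, $(\overline D^\cdot,d)$ of $C^\cdot$, $D^\cdot$ and a morphism $f:C^\cdot\to D^\cdot$ of $D^+(\mathcal C)$, let $L_F(f)=L_F(f\,|\,\overline C^\cdot,\overline D^\cdot)$ be the set of morphisms $\overline f:\overline C^\cdot\to\overline D^\cdot$ with $F(\overline f)\,c=d\,f$. Put $$\mathbf C=R\mathrm{Hom}_{\mathcal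 C_0}\bigl(R\mathrm{Hom}_R(J,C^\cdot),\,R\mathrm{Hom}_R(S,D^\cdot)\bigr),$$ where $H^nR\mathrm{Hom}_{\mathcal C_0}(A,B)=\mathrm{Ext}^n_{\mathcal C_0}(A,B)=\mathrm{Hom}_{D^+(\mathcal C_0)}(A,B[n])$. **Theorem.** Let $C^\cdot,D^\cdot\in D^+(\mathcal C)$ and let $\overline C^\cdot,\overline D^\cdot$ be lifts of them along $F$. 1. For every morphism $f:C^\cdot\to D^\cdot$ in $D^+(\mathcal C)$ there is an obstruction $o(f\,|\,\overline C^\cdot,\overline D^\cdot)\in H^1\mathbf C$, depending additively on $f$, with $$o(f\,|\,\overline C^\cdot,\overline D^\cdot)=0\iff L_F(f\,|\,\overline C^\cdot,\overline D^\cdot)\neq\varnothing .$$ 2. Suppose $\mathrm{Ext}^{-1}_{\mathcal C}(C^\cdot,D^\cdot)=0$. If $o(f\,|\,\overline C^\cdot,\overline D^\cdot)=0$, then $L_F(f\,|\,\overline C^\cdot,\overline D^\cdot)$ is affine over $H^0\mathbf C$, i.e. it is non-empty and $H^0\mathbf C$ acts on it simply transitively. These actions are given by translation, $\overline f\mapsto\overline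 f+t(a)$ for $a\in H^0\mathbf C$, for one homomorphism $t:H^0\mathbf C\to\mathrm{Hom}_{D^+(\overline{\mathcal C})}(\overline C^\cdot,\overline D^\cdot)$ that is independent of $f$. -/

import Mathlib

open CategoryTheory CategoryTheory.Limits

universe w u₁ v₁ u₂ v₂

noncomputable section

namespace DerivedLift

/-- A commutative ring is coherent if its finitely generated ideals are finitely presented. -/
def IsCoherentRing (R : Type*) [CommRing R] : Prop :=
  ∀ I : Ideal R, I.FG → Module.FinitePresentation R I

/-! ### The objects `Hom_R(M, Y)` of an `R`-linear abelian category

All modules are taken over a ring `A` mapping to `R` by `σ : A →+* R`. For `σ = id` this is the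
ordinary notion. If `σ` is surjective and the action of `A` on `M` factors through `R`, then
the `σ`-semilinear maps out of `M` are the `R`-linear maps out of the `R`-module `M`. -/

section LinHom

variable {A : Type*} {R : Type*} [CommRing A] [CommRing R] (σ : A →+* R)
  (M : Type*) [AddCommGroup M] [Module A M]
  {C : Type u₁} [Category.{v₁} C] [Abelian C] [Linear R C]

/-- `(H, e)` is an object `Hom_R(M, Y)`: it represents the functor
`X ↦ Hom_R(M, Hom_C(X, Y))`, with universal element `e`. -/
structure IsLinHom (Y H : C) (e : M →ₛₗ[σ] (H ⟶ Y)) : Prop where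
  existsUnique : ∀ (X : C) (φ : M →ₛₗ[σ] (X ⟶ Y)), ∃! u : X ⟶ H, ∀ m, u ≫ e m = φ m

/-- If `M` is finitely presented, then `Hom_R(M, Y)` exists: it is the kernel of the map
between finite powers of `Y` given by a presentation of `M`. -/
theorem exists_isLinHom (hM : Module.FinitePresentation A M) (Y : C) :
    ∃ (H : C) (e : M →ₛₗ[σ] (H ⟶ Y)), IsLinHom σ M Y H e := by
  classical
  obtain ⟨s, hs, t, ht⟩ := hM.out
  set L := Finsupp.linearCombination A ((↑) : s → M) with hL
  have hsurj : Function.Surjective L := by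
    rw [← LinearMap.range_eq_top, hL, Finsupp.range_linearCombination]
    simpa using hs
  let d : (∏ᶜ fun _ : s => Y) ⟶ (∏ᶜ fun _ : t => Y) :=
    Pi.lift fun r => ∑ i : s, σ ((r : s →₀ A) i) • Pi.π (fun _ : s => Y) i
  let p : s → (kernel d ⟶ Y) := fun i => kernel.ι d ≫ Pi.π (fun _ : s => Y) i
  let E : (s →₀ A) →ₛₗ[σ] (kernel d ⟶ Y) :=
    { toFun := fun v => ∑ i : s, σ (v i) • p i
      map_add' := fun v w => by simp [add_smul, Finset.sum_add_distrib]
      map_smul' := fun a v => by simp [mul_smul, Finset.smul_sum] }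
  have hE : LinearMap.ker L ≤ LinearMap.ker E := by
    rw [← ht, Submodule.span_le]
    intro r hr
    have h := kernel.condition_assoc d (Pi.π (fun _ : t => Y) ⟨r, hr⟩)
    simp only [d, limit.lift_π, Fan.mk_π_app, zero_comp, Preadditive.comp_sum,
      Linear.comp_smul] at h
    exact h
  have hE' : ∀ v w, L v = L w → E v = E w := fun v w h => by
    rw [← sub_eq_zero, ← map_sub]
    exact hE (by simp [h])
  have hsec := Function.surjInv_eq hsurj
  let e : M →ₛₗ[σ] (kernel d ⟶ Y) :=
    { toFun := fun m => E (Function.surjInv hsurj m)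
      map_add' := fun m n => by
        rw [← map_add]
        exact hE' _ _ (by simp [hsec])
      map_smul' := fun a m => by
        rw [← map_smulₛₗ]
        exact hE' _ _ (by simp [hsec]) }
  have he : ∀ v, e (L v) = E v := fun v => hE' _ _ (hsec _)
  have hE1 : ∀ i : s, E (Finsupp.single i 1) = p i := fun i => by
    change ∑ j : s, σ (Finsupp.single i 1 j) • p j = p i
    rw [Finset.sum_eq_single i]
    · simp
    · intro j _ hj
      simp [Finsupp.single_eq_of_ne hj]
    · simp
  have hes : ∀ i : s, e (i : M) = p i := fun i => by
    rw [← hE1, ← he]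
    simp [hL]
  refine ⟨kernel d, e, ⟨fun X φ => ?_⟩⟩
  have hLv : ∀ v : s →₀ A, L v = ∑ i : s, v i • (i : M) := fun v => by
    rw [hL, Finsupp.linearCombination_apply, Finsupp.sum_fintype _ _ (by simp)]
  have hφ : ∀ v : s →₀ A, φ (L v) = ∑ i : s, σ (v i) • φ (i : M) := fun v => by
    rw [hLv, map_sum]
    simp only [map_smulₛₗ]
  let w : X ⟶ ∏ᶜ fun _ : s => Y := Pi.lift fun i => φ (i : M)
  have hw : w ≫ d = 0 := by
    refine Pi.hom_ext _ _ fun r => ?_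
    have hr : (r : s →₀ A) ∈ LinearMap.ker L := ht ▸ Submodule.subset_span r.2
    have := hφ r
    rw [LinearMap.mem_ker.mp hr, map_zero] at this
    simp only [w, d, Category.assoc, limit.lift_π, Fan.mk_π_app, zero_comp,
      Preadditive.comp_sum, Linear.comp_smul]
    exact this.symm
  refine ⟨kernel.lift d w hw, fun m => ?_, fun u hu => ?_⟩
  · obtain ⟨v, rfl⟩ := hsurj m
    rw [he, hφ]
    change _ ≫ (∑ i : s, σ (v i) • p i) = _
    simp [p, w, Preadditive.comp_sum]
  · rw [← cancel_mono (kernel.ι d)]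
    refine Pi.hom_ext _ _ fun i => ?_
    have := hu (i : M)
    rw [hes] at this
    simp [w, ← this, p]

variable {M} (hM : Module.FinitePresentation A M)

/-- The object `Hom_R(M, Y)`. -/
def linHom (Y : C) : C := (exists_isLinHom σ M hM Y).choose

/-- The universal element `M → Hom_C(Hom_R(M, Y), Y)`. -/
def linHomEv (Y : C) : M →ₛₗ[σ] (linHom σ hM Y ⟶ Y) :=
  (exists_isLinHom σ M hM Y).choose_spec.choose

theorem isLinHom (Y : C) : IsLinHom σ M Y (linHom σ hM Y) (linHomEv σ hM Y) :=
  (exists_isLinHom σ M hM Y).choose_spec.choose_spec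

variable {σ} {hM}

/-- The morphism `X ⟶ Hom_R(M, Y)` given by a linear map `M → Hom_C(X, Y)`. -/
def linHomLift {X Y : C} (φ : M →ₛₗ[σ] (X ⟶ Y)) : X ⟶ linHom σ hM Y :=
  ((isLinHom σ hM Y).existsUnique X φ).choose

@[simp]
theorem linHomLift_ev {X Y : C} (φ : M →ₛₗ[σ] (X ⟶ Y)) (m : M) :
    linHomLift (hM := hM) φ ≫ linHomEv σ hM Y m = φ m :=
  ((isLinHom σ hM Y).existsUnique X φ).choose_spec.1 m

theorem linHom_ext {X Y : C} {u v : X ⟶ linHom σ hM Y}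
    (h : ∀ m, u ≫ linHomEv σ hM Y m = v ≫ linHomEv σ hM Y m) : u = v := by
  let φ : M →ₛₗ[σ] (X ⟶ Y) :=
    { toFun := fun m => v ≫ linHomEv σ hM Y m
      map_add' := fun m n => by simp
      map_smul' := fun a m => by simp [map_smulₛₗ] }
  exact ((isLinHom σ hM Y).existsUnique X φ).unique h (fun _ => rfl)

variable (σ hM)

/-- The morphism `Hom_R(M, Y) ⟶ Hom_R(M, Z)` induced by `Y ⟶ Z`. -/
def linHomMap {Y Z : C} (g : Y ⟶ Z) : linHom σ hM Y ⟶ linHom σ hM Z :=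
  linHomLift
    { toFun := fun m => linHomEv σ hM Y m ≫ g
      map_add' := fun m n => by simp
      map_smul' := fun a m => by simp [map_smulₛₗ] }

@[simp]
theorem linHomMap_ev {Y Z : C} (g : Y ⟶ Z) (m : M) :
    linHomMap σ hM g ≫ linHomEv σ hM Z m = linHomEv σ hM Y m ≫ g := by
  simp [linHomMap]

variable (C) in
/-- The functor `Hom_R(M, -) : C ⥤ C`. -/
def linHomFunctor : C ⥤ C where
  obj Y := linHom σ hM Y
  map g := linHomMap σ hM g
  map_id Y := linHom_ext fun m => by simp
  map_comp g h := linHom_ext fun m => by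
    have := linHomMap_ev σ hM g m =≫ h
    rw [linHomMap_ev, Category.assoc, linHomMap_ev]
    rw [Category.assoc, Category.assoc] at this
    exact this.symm

instance : (linHomFunctor σ C hM).Additive where
  map_add {X Y f g} := linHom_ext (σ := σ) (hM := hM) fun m => by
    change linHomMap σ hM (f + g) ≫ _ = (linHomMap σ hM f + linHomMap σ hM g) ≫ _
    rw [Preadditive.add_comp, linHomMap_ev, linHomMap_ev, linHomMap_ev, Preadditive.comp_add]

end LinHom

/-! ### Coflat objects and flat abelian categories -/

section Flat

variable {R : Type w} [CommRing R] {C : Type u₁} [Category.{v₁} C] [Abelian C] [Linear R C]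

section

variable {M₁ M₂ M₃ : Type*} [AddCommGroup M₁] [AddCommGroup M₂] [AddCommGroup M₃]
  [Module R M₁] [Module R M₂] [Module R M₃]
  (h₁ : Module.FinitePresentation R M₁) (h₂ : Module.FinitePresentation R M₂)
  (h₃ : Module.FinitePresentation R M₃)

/-- The morphism `Hom_R(M₂, Y) ⟶ Hom_R(M₁, Y)` induced by a linear map `M₁ → M₂`. -/
def linHomPrecomp (f : M₁ →ₗ[R] M₂) (Y : C) :
    linHom (RingHom.id R) h₂ Y ⟶ linHom (RingHom.id R) h₁ Y :=
  linHomLift (linHomEv (RingHom.id R) h₂ Y ∘ₛₗ f)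

theorem linHomPrecomp_comp_eq_zero {f : M₁ →ₗ[R] M₂} {g : M₂ →ₗ[R] M₃}
    (h : Function.Exact f g) (Y : C) :
    linHomPrecomp h₂ h₃ g Y ≫ linHomPrecomp h₁ h₂ f Y = 0 :=
  linHom_ext fun m => by
    rw [Category.assoc, linHomPrecomp, linHomPrecomp, linHomLift_ev, LinearMap.comp_apply,
      linHomLift_ev, LinearMap.comp_apply, h.apply_apply_eq_zero]
    simp

/-- The sequence `Hom_R(M₃, Y) ⟶ Hom_R(M₂, Y) ⟶ Hom_R(M₁, Y)` attached to an exact sequence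
`M₁ → M₂ → M₃`. -/
def linHomShortComplex {f : M₁ →ₗ[R] M₂} {g : M₂ →ₗ[R] M₃} (h : Function.Exact f g) (Y : C) :
    ShortComplex C :=
  ShortComplex.mk (linHomPrecomp h₂ h₃ g Y) (linHomPrecomp h₁ h₂ f Y)
    (linHomPrecomp_comp_eq_zero h₁ h₂ h₃ h Y)

end

variable (R) in
/-- An object `Y` is coflat if the contravariant functor `Hom_R(-, Y)` from finitely presented
`R`-modules to `C` is exact: it sends every short exact sequence
`0 → M₁ → M₂ → M₃ → 0` of finitely presented modules to a short exact sequence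
`0 → Hom_R(M₃, Y) → Hom_R(M₂, Y) → Hom_R(M₁, Y) → 0`. -/
def IsCoflat (Y : C) : Prop :=
  ∀ (M₁ M₂ M₃ : Type w) [AddCommGroup M₁] [AddCommGroup M₂] [AddCommGroup M₃]
    [Module R M₁] [Module R M₂] [Module R M₃]
    (h₁ : Module.FinitePresentation R M₁) (h₂ : Module.FinitePresentation R M₂)
    (h₃ : Module.FinitePresentation R M₃) (f : M₁ →ₗ[R] M₂) (g : M₂ →ₗ[R] M₃)
    (h : Function.Exact f g), Function.Injective f → Function.Surjective g →
      (linHomShortComplex h₁ h₂ h₃ h Y).ShortExact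

variable (R C) in
/-- Flatness of an `R`-linear abelian category with enough injectives: injectives are coflat. -/
def IsFlatAbelian : Prop := ∀ Y : C, Injective Y → IsCoflat R Y

end Flat

/-! ### Abelian deformations -/

section Deformation

variable {R S : Type*} [CommRing R] [CommRing S] (q : R →+* S)
  {C : Type u₁} [Category.{v₁} C] [Abelian C] [Linear R C]
  {D : Type u₂} [Category.{v₂} D] [Abelian D] [Linear S D]

variable (C) in
/-- The `S`-objects of the `R`-linear category `C`, for `q : R →+* S`: the objects which have
an `S`-structure `S → C(Y, Y)` extending the `R`-structure. (For surjective `q` this structure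
is unique and respected by all morphisms, so that the category `C_S` of `S`-objects is the full
subcategory of `C` on these objects.) -/
def isSObject : ObjectProperty C :=
  fun Y => ∃ φ : S →+* End Y, ∀ r : R, φ (q r) = algebraMap R (End Y) r

/-- A functor `ι : D ⥤ C` from an `S`-linear to an `R`-linear category is `R`-linear. -/
structure IsLinearAlong (ι : D ⥤ C) : Prop where
  map_add : ∀ {X Y : D} (f g : X ⟶ Y), ι.map (f + g) = ι.map f + ι.map g
  map_smul : ∀ {X Y : D} (r : R) (f : X ⟶ Y), ι.map (q r • f) = r • ι.map f

variable {q}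

theorem IsLinearAlong.isSObject {ι : D ⥤ C} (h : IsLinearAlong q ι) (X : D) :
    isSObject q C (ι.obj X) := by
  refine ⟨{ toFun := fun s => ι.map (s • 𝟙 X)
            map_one' := by simp
            map_mul' := fun s t => ?_
            map_zero' := ?_
            map_add' := fun s t => by rw [add_smul, h.map_add] }, fun r => ?_⟩
  · rw [End.mul_def, ← ι.map_comp]
    simp [mul_smul]
  · have := h.map_add (0 : X ⟶ X) 0
    simpa using this
  · change ι.map (q r • 𝟙 X) = _
    rw [h.map_smul, ι.map_id]
    rfl

variable (q) in
/-- An abelian deformation of the `S`-linear category `D` along `q : R →+* S` (surjective): an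
`R`-linear functor `ι : D ⥤ C` inducing an equivalence between `D` and the category of
`S`-objects in the `R`-linear abelian category `C`. -/
structure IsDeformation (ι : D ⥤ C) : Prop where
  linear : IsLinearAlong q ι
  isEquivalence : ((isSObject q C).lift ι linear.isSObject).IsEquivalence

theorem IsDeformation.additive {ι : D ⥤ C} (h : IsDeformation q ι) : ι.Additive where
  map_add {_ _ f g} := h.linear.map_add f g

/-- If the kernel of the surjection `q : R →+* S` is finitely generated, then the inclusion
`ι : D ⥤ C` of a deformation has a right adjoint. -/
theorem IsDeformation.isLeftAdjoint {ι : D ⥤ C} (h : IsDeformation q ι)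
    (hq : Function.Surjective q) (hq' : (RingHom.ker q).FG) : ι.IsLeftAdjoint := by
  have := h.isEquivalence
  have hfp : Module.FinitePresentation R (R ⧸ RingHom.ker q) :=
    Module.finitePresentation_of_surjective (Submodule.mkQ (RingHom.ker q))
      (Submodule.mkQ_surjective _) (by rwa [Submodule.ker_mkQ])
  refine Functor.isLeftAdjoint_of_rightAdjointObjIsDefined_eq_top ?_
  ext Y
  simp only [Pi.top_apply, Prop.top_eq_true, iff_true]
  let one : R ⧸ RingHom.ker q := Submodule.Quotient.mk 1
  have hone : ∀ r : R, Submodule.Quotient.mk (p := RingHom.ker q) r = r • one := fun r => by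
    rw [← Submodule.Quotient.mk_smul, smul_eq_mul, mul_one]
  have hzero : ∀ r : R, q r = 0 → ∀ m : R ⧸ RingHom.ker q, r • m = 0 := fun r hr m => by
    obtain ⟨t, rfl⟩ := Submodule.Quotient.mk_surjective _ m
    rw [← Submodule.Quotient.mk_smul, Submodule.Quotient.mk_eq_zero, smul_eq_mul]
    exact Ideal.mul_mem_right _ _ hr
  let K : C := linHom (RingHom.id R) hfp Y
  let ε : K ⟶ Y := linHomEv (RingHom.id R) hfp Y one
  have hext : ∀ {X : C} (u v : X ⟶ K), u ≫ ε = v ≫ ε → u = v := fun u v huv =>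
    linHom_ext fun m => by
      obtain ⟨t, rfl⟩ := Submodule.Quotient.mk_surjective _ m
      rw [hone, map_smulₛₗ, Linear.comp_smul, Linear.comp_smul]
      exact congrArg _ huv
  have hK : isSObject q C K := by
    have hker : ∀ r : R, q r = 0 → algebraMap R (End K) r = 0 := fun r hr => by
      rw [Algebra.algebraMap_eq_smul_one]
      refine hext (r • 𝟙 K) 0 ?_
      rw [Linear.smul_comp, Category.id_comp, zero_comp]
      change r • linHomEv (RingHom.id R) hfp Y one = 0
      have := map_smulₛₗ (linHomEv (RingHom.id R) hfp Y) r one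
      rw [hzero r hr, map_zero] at this
      exact this.symm
    refine ⟨(Ideal.Quotient.lift (RingHom.ker q) (algebraMap R (End K)) hker).comp
      (RingHom.quotientKerEquivOfSurjective hq).symm.toRingHom, fun r => ?_⟩
    have : (RingHom.quotientKerEquivOfSurjective hq).symm (q r) =
        Ideal.Quotient.mk (RingHom.ker q) r := by
      rw [RingEquiv.symm_apply_eq]
      rfl
    simp only [RingHom.comp_apply, RingEquiv.toRingHom_eq_coe, RingHom.coe_coe, this]
    exact Ideal.Quotient.lift_mk _ _ _
  let i : ι.obj (((isSObject q C).lift ι h.linear.isSObject).objPreimage ⟨K, hK⟩) ≅ K :=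
    (isSObject q C).ι.mapIso
      (((isSObject q C).lift ι h.linear.isSObject).objObjPreimageIso ⟨K, hK⟩)
  have hkill : ∀ (X : D) (r : R) (g : ι.obj X ⟶ Y), q r = 0 → r • g = 0 := fun X r g hr => by
    have h1 := h.linear.map_smul r (𝟙 X)
    have h2 := h.linear.map_add (0 : X ⟶ X) 0
    rw [hr, zero_smul] at h1
    rw [add_zero, left_eq_add] at h2
    rw [h2, ι.map_id] at h1
    rw [← Category.id_comp g, ← Linear.smul_comp, ← h1, zero_comp]
  have hfull : ∀ {X X' : D} (g : ι.obj X ⟶ ι.obj X'), ∃ g' : X ⟶ X', ι.map g' = g := fun g => by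
    obtain ⟨g', hg'⟩ := ((isSObject q C).lift ι h.linear.isSObject).map_surjective
      (ObjectProperty.homMk g)
    exact ⟨g', congrArg (fun k => k.hom) hg'⟩
  have hfaith : ∀ {X X' : D} (g g' : X ⟶ X'), ι.map g = ι.map g' → g = g' := fun g g' hg =>
    ((isSObject q C).lift ι h.linear.isSObject).map_injective
      ((isSObject q C).hom_ext hg)
  refine (Functor.RepresentableBy.isRepresentable
    (Y := ((isSObject q C).lift ι h.linear.isSObject).objPreimage ⟨K, hK⟩)
    { homEquiv := fun {X} => Equiv.ofBijective
        (fun u => (ι.map u ≫ i.hom ≫ ε : ι.obj X ⟶ Y)) ⟨fun u v huv => ?_, fun g => ?_⟩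
      homEquiv_comp := fun f g => by
        change ι.map (f ≫ g) ≫ i.hom ≫ ε = ι.map f ≫ ι.map g ≫ i.hom ≫ ε
        rw [ι.map_comp, Category.assoc] })
  · apply hfaith
    rw [← cancel_mono i.hom]
    exact hext _ _ (by simpa using huv)
  · change ι.obj X ⟶ Y at g
    let φ : R ⧸ RingHom.ker q →ₗ[R] (ι.obj X ⟶ Y) :=
      Submodule.liftQ (RingHom.ker q) (LinearMap.toSpanSingleton R _ g) (fun r hr => by
        rw [LinearMap.mem_ker, LinearMap.toSpanSingleton_apply]
        exact hkill X r g hr)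
    obtain ⟨u, hu⟩ := hfull (linHomLift (hM := hfp) φ ≫ i.inv)
    refine ⟨u, ?_⟩
    change ι.map u ≫ i.hom ≫ ε = g
    rw [hu, Category.assoc, i.inv_hom_id_assoc, linHomLift_ev]
    change (1 : R) • g = g
    rw [one_smul]

/-- The right adjoint `Hom_R(S, -) : C ⥤ D` of the inclusion of a deformation. -/
def homS {ι : D ⥤ C} (h : IsDeformation q ι)
    (hq : Function.Surjective q) (hq' : (RingHom.ker q).FG) : C ⥤ D :=
  haveI := h.isLeftAdjoint hq hq'
  ι.rightAdjoint

instance {ι : D ⥤ C} (h : IsDeformation q ι)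
    (hq : Function.Surjective q) (hq' : (RingHom.ker q).FG) : (homS h hq hq').Additive :=
  haveI := h.isLeftAdjoint hq hq'
  haveI := h.additive
  (Adjunction.ofIsLeftAdjoint ι).right_adjoint_additive

/-- The functor `Hom_R(J, -) : C ⥤ D`, where `J` is the kernel of a surjection `p : A →+* R`.
Here `J` is an `R`-module through `A`, if `J ^ 2 = 0`. If moreover `ker (q ∘ p)` annihilates `J`,
then the objects `Hom_R(J, Y)` of `C` are `S`-objects, and on these the right adjoint
`Hom_R(S, -)` is inverse to the inclusion `ι : D ⥤ C`. -/
def homJ {A : Type*} [CommRing A] (p : A →+* R) (hA : IsCoherentRing A)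
    (hp' : (RingHom.ker p).FG) {ι : D ⥤ C} (h : IsDeformation q ι)
    (hq : Function.Surjective q) (hq' : (RingHom.ker q).FG) : C ⥤ D :=
  linHomFunctor p C (hA _ hp') ⋙ homS h hq hq'

instance {A : Type*} [CommRing A] (p : A →+* R) (hA : IsCoherentRing A)
    (hp' : (RingHom.ker p).FG) {ι : D ⥤ C} (h : IsDeformation q ι)
    (hq : Function.Surjective q) (hq' : (RingHom.ker q).FG) :
    (homJ p hA hp' h hq hq').Additive :=
  inferInstanceAs (linHomFunctor p C (hA _ hp') ⋙ homS h hq hq').Additive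

/-- The derived functor `RHom_R(S, -) : D^+(C) ⥤ D^+(D)` for a deformation `ι : D ⥤ C`. -/
abbrev RHomS [EnoughInjectives C] [HasDerivedCategory C] [HasDerivedCategory D]
    {ι : D ⥤ C} (h : IsDeformation q ι)
    (hq : Function.Surjective q) (hq' : (RingHom.ker q).FG) :
    DerivedCategory.Plus C ⥤ DerivedCategory.Plus D :=
  (homS h hq hq').rightDerivedFunctorPlus

/-- The derived functor `RHom_R(J, -) : D^+(C) ⥤ D^+(D)`, where `J = ker p`. -/
abbrev RHomJ [EnoughInjectives C] [HasDerivedCategory C] [HasDerivedCategory D]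
    {A : Type*} [CommRing A] (p : A →+* R) (hA : IsCoherentRing A)
    (hp' : (RingHom.ker p).FG) {ι : D ⥤ C} (h : IsDeformation q ι)
    (hq : Function.Surjective q) (hq' : (RingHom.ker q).FG) :
    DerivedCategory.Plus C ⥤ DerivedCategory.Plus D :=
  (homJ p hA hp' h hq hq').rightDerivedFunctorPlus

end Deformation

/-! ### Lifts along a functor -/

section Lift

variable {A : Type u₁} [Category.{v₁} A] {B : Type u₂} [Category.{v₂} B] (F : A ⥤ B)

/-- A lift along `F` of an object `X`: an object of the source with an isomorphism of `X` to its
image. -/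
structure ObjLift (X : B) where
  /-- the lifted object -/
  obj : A
  /-- the comparison isomorphism -/
  iso : X ≅ F.obj obj

variable {F}

/-- The set of lifts along `F` of a morphism `f : X ⟶ Y` relative to lifts of `X` and `Y`. -/
def MapLift {X Y : B} (f : X ⟶ Y) (x : ObjLift F X) (y : ObjLift F Y) : Type v₁ :=
  { g : x.obj ⟶ y.obj // x.iso.hom ≫ F.map g = f ≫ y.iso.hom }

end Lift

/-- `H^n RHom_C(X, Y) = Ext^n_C(X, Y)` for `X` and `Y` in `D^+(C)`: the group of morphisms
`X ⟶ Y[n]` in the derived category. -/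
abbrev RHomCohomology {C : Type u₁} [Category.{v₁} C] [Abelian C] [HasDerivedCategory.{w} C]
    (X Y : DerivedCategory.Plus C) (n : ℤ) : Type w :=
  ShiftedHom X Y n

end DerivedLift

end

open DerivedLift

/-! The inclusion `ιb` is exact, so it induces a functor `G` on bounded below derived categories,
left adjoint to `F`. Write `x`, `y` for the lifted objects and `φ_f : G(F x) ⟶ y` for the adjunct of
`f`. Lifting `f` means extending `φ_f` along the counit `G(F x) ⟶ x`. Complete the counit to a
distinguished triangle `G(F x) ⟶ x ⟶ K ⟶ G(F x)[1]`. The obstruction is the composite `K ⟶ G(F x)[1]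
⟶ y[1]` with `φ_f[1]`. Two lifts differ by a morphism killed by the counit, that is, one coming from
`Hom(K, y)`. The map `Hom(K, y) → Hom(x, y)` is injective once `Hom(G(F x)[1], y) ≅ Ext^{-1}(X, Y)`
vanishes (`exists_obstruction`).

It remains to compute `K` (`nonempty_obj₃_iso_RHomJ`). Represent `x` by a complex `E` of injectives.
Flatness makes `0 → Hom(R, E) → E → Hom(J, E) → 0` exact, and its first map represents the derived
counit, so `K` is represented by `Hom(J, E)`. As `J ^ 2 = 0`, this is `Hom_R(J, Hom(R, E))`; as `I J
= 0`, it comes from the smallest category. Since `Hom(R, E)` is again injective, `K` is the image of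
`RHom_R(J, X)` under both inclusions. The two derived adjunctions then turn `Hom(K, y[n])` into
`H^n` of `RHom(RHom_R(J, X), RHom_R(S, Y))`. -/

noncomputable section

namespace DerivedLift

/-! ### The inclusion of a deformation -/

section Deformation

variable {R S : Type*} [CommRing R] [CommRing S] {q : R →+* S}
  {C : Type u₁} [Category.{v₁} C] [Abelian C] [Linear R C]
  {D : Type u₂} [Category.{v₂} D] [Abelian D] [Linear S D]

/-- Objects annihilated by the kernel of a surjection `q : R →+* S` are `S`-objects. -/
theorem isSObject_of_smul_eq_zero (hq : Function.Surjective q) {Y : C}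
    (hY : ∀ r : R, q r = 0 → r • 𝟙 Y = 0) : isSObject q C Y := by
  have hker : ∀ r : R, r ∈ RingHom.ker q → algebraMap R (End Y) r = 0 := fun r hr => by
    rw [Algebra.algebraMap_eq_smul_one]
    exact hY r hr
  refine ⟨(Ideal.Quotient.lift (RingHom.ker q) (algebraMap R (End Y)) hker).comp
    (RingHom.quotientKerEquivOfSurjective hq).symm.toRingHom, fun r => ?_⟩
  have : (RingHom.quotientKerEquivOfSurjective hq).symm (q r) =
      Ideal.Quotient.mk (RingHom.ker q) r := by
    rw [RingEquiv.symm_apply_eq]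
    rfl
  simp only [RingHom.comp_apply, RingEquiv.toRingHom_eq_coe, RingHom.coe_coe, this]
  exact Ideal.Quotient.lift_mk _ _ _

variable {ι : D ⥤ C} (h : IsDeformation q ι)

include h

theorem IsDeformation.full : ι.Full :=
  haveI := h.isEquivalence
  inferInstanceAs ((isSObject q C).lift ι h.linear.isSObject ⋙ (isSObject q C).ι).Full

theorem IsDeformation.faithful : ι.Faithful :=
  haveI := h.isEquivalence
  inferInstanceAs ((isSObject q C).lift ι h.linear.isSObject ⋙ (isSObject q C).ι).Faithful

theorem IsDeformation.mem_essImage {Y : C} (hY : isSObject q C Y) : ι.essImage Y := by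
  have := h.isEquivalence
  exact ⟨((isSObject q C).lift ι h.linear.isSObject).objPreimage ⟨Y, hY⟩,
    ⟨(isSObject q C).ι.mapIso
      (((isSObject q C).lift ι h.linear.isSObject).objObjPreimageIso ⟨Y, hY⟩)⟩⟩

theorem IsDeformation.smul_eq_zero (X : D) {Y : C} (g : Y ⟶ ι.obj X) (r : R) (hr : q r = 0) :
    r • g = 0 := by
  have := h.additive
  have h1 := h.linear.map_smul r (𝟙 X)
  rw [hr, zero_smul, ι.map_zero, ι.map_id] at h1
  rw [← Category.comp_id g, ← Linear.comp_smul, ← h1, comp_zero]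

/-- A monomorphism detects the vanishing of the action of `ker q`. Closure under subobjects is what
makes the inclusion left exact. -/
theorem IsDeformation.mem_essImage_of_mono (hq : Function.Surjective q) {X : D} {K : C}
    (i : K ⟶ ι.obj X) [Mono i] : ι.essImage K :=
  h.mem_essImage (isSObject_of_smul_eq_zero hq fun r hr => by
    rw [← cancel_mono i, Linear.smul_comp, Category.id_comp, zero_comp, h.smul_eq_zero X i r hr])

/-- The kernel of `ι.map f`, taken in `C`, is a subobject of an `S`-object. By fullness its
inclusion comes from some `k` in `D` with `k ≫ f = 0`, so it vanishes. -/
theorem IsDeformation.preservesMonomorphisms (hq : Function.Surjective q) :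
    ι.PreservesMonomorphisms where
  preserves {A B} f hf := by
    have := h.full
    have := h.faithful
    have := h.additive
    obtain ⟨K, ⟨e⟩⟩ := h.mem_essImage_of_mono hq (kernel.ι (ι.map f))
    refine Preadditive.mono_of_kernel_zero ?_
    obtain ⟨k, hk⟩ := ι.map_surjective (e.hom ≫ kernel.ι (ι.map f))
    have hkf : k ≫ f = 0 := ι.map_injective (by
      rw [ι.map_comp, hk, Category.assoc, kernel.condition, comp_zero, ι.map_zero])
    rw [← cancel_epi e.hom, ← hk, zero_of_comp_mono f hkf, ι.map_zero, comp_zero]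

theorem IsDeformation.preservesFiniteColimits
    (hq : Function.Surjective q) (hq' : (RingHom.ker q).FG) : PreservesFiniteColimits ι :=
  have := h.isLeftAdjoint hq hq'
  have := (Adjunction.ofIsLeftAdjoint ι).leftAdjoint_preservesColimits
  inferInstance

theorem IsDeformation.preservesFiniteLimits
    (hq : Function.Surjective q) (hq' : (RingHom.ker q).FG) : PreservesFiniteLimits ι := by
  have := h.additive
  have := h.preservesFiniteColimits hq hq'
  have := h.preservesMonomorphisms hq
  rw [Functor.preservesFiniteLimits_iff_forall_exact_map_and_mono]
  intro T hT
  have := hT.mono_f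
  have := hT.epi_g
  exact ⟨((Functor.preservesFiniteColimits_iff_forall_exact_map_and_epi ι).1
    inferInstance T hT).1, inferInstance⟩

/-- The adjunction between the inclusion of a deformation and `Hom_R(S, -)`. -/
def homSAdj (hq : Function.Surjective q) (hq' : (RingHom.ker q).FG) : ι ⊣ homS h hq hq' :=
  haveI := h.isLeftAdjoint hq hq'
  Adjunction.ofIsLeftAdjoint ι

/-- A right adjoint of a functor preserving monomorphisms preserves injectives. Hence `Hom(R, E)`
can be used to compute further derived functors. -/
theorem injective_homS (hq : Function.Surjective q) (hq' : (RingHom.ker q).FG)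
    (Y : C) [Injective Y] : Injective ((homS h hq hq').obj Y) :=
  have := h.preservesMonomorphisms hq
  (homSAdj h hq hq').map_injective _ inferInstance

theorem mono_homSAdj_counit (hq : Function.Surjective q) (hq' : (RingHom.ker q).FG) (Y : C) :
    Mono ((homSAdj h hq hq').counit.app Y) := by
  have := h.full
  have := h.faithful
  have := h.additive
  set ε := (homSAdj h hq hq').counit.app Y
  obtain ⟨K, ⟨e⟩⟩ := h.mem_essImage_of_mono hq (kernel.ι ε)
  refine Preadditive.mono_of_kernel_zero ?_
  obtain ⟨k, hk⟩ := ι.map_surjective (e.hom ≫ kernel.ι ε)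
  have hk0 : k = 0 := ((homSAdj h hq hq').homEquiv _ _).symm.injective (by
    rw [Adjunction.homEquiv_counit, Adjunction.homEquiv_counit, hk, ι.map_zero, zero_comp,
      Category.assoc, kernel.condition, comp_zero])
  rw [← cancel_epi e.hom, ← hk, hk0, ι.map_zero, comp_zero]

end Deformation

/-! ### The action of an ideal -/

section Act

variable {R : Type*} [CommRing R] {C : Type u₁} [Category.{v₁} C] [Abelian C] [Linear R C]
  {I : Ideal R} (hI : Module.FinitePresentation R I)

/-- The morphism `Y ⟶ Hom_R(I, Y)` given by the action of the ideal `I` on `Y`. -/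
def toLinHom (Y : C) : Y ⟶ linHom (RingHom.id R) hI Y :=
  linHomLift
    { toFun := fun r => (r : R) • 𝟙 Y
      map_add' := fun r s => by simp [add_smul]
      map_smul' := fun r s => by simp [mul_smul] }

@[simp]
theorem toLinHom_ev (Y : C) (r : I) :
    toLinHom hI Y ≫ linHomEv (RingHom.id R) hI Y r = (r : R) • 𝟙 Y := by
  simp [toLinHom]

theorem toLinHom_naturality {Y Z : C} (g : Y ⟶ Z) :
    g ≫ toLinHom hI Z = toLinHom hI Y ≫ linHomMap (RingHom.id R) hI g :=
  linHom_ext fun r => by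
    have := toLinHom_ev hI Y r =≫ g
    rw [Category.assoc] at this
    simp [this]

theorem comp_toLinHom_eq_zero_iff {X Y : C} (u : X ⟶ Y) :
    u ≫ toLinHom hI Y = 0 ↔ ∀ r ∈ I, r • u = 0 := by
  refine ⟨fun hu r hr => ?_, fun hu => linHom_ext fun r => ?_⟩
  · have := hu =≫ linHomEv (RingHom.id R) hI Y ⟨r, hr⟩
    simpa using this
  · simpa using hu r r.2

end Act

/-- Coflatness applied to `0 → I → R → R/I → 0` makes `Hom(R, Y) ⟶ Hom(I, Y)` epi, and this map
factors through `toLinHom` by evaluation at `1`. -/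
theorem IsCoflat.epi_toLinHom {R : Type w} [CommRing R] {C : Type u₁} [Category.{v₁} C]
    [Abelian C] [Linear R C] {I : Ideal R} (hI : Module.FinitePresentation R I)
    (hI' : I.FG) {Y : C} (hY : IsCoflat R Y) : Epi (toLinHom hI Y) := by
  have hfp : Module.FinitePresentation R (R ⧸ I) :=
    Module.finitePresentation_of_surjective (Submodule.mkQ I)
      (Submodule.mkQ_surjective _) (by rwa [Submodule.ker_mkQ])
  have hR : Module.FinitePresentation R R := inferInstance
  have hex := hY I R (R ⧸ I) hI hR hfp I.subtype I.mkQ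
    (LinearMap.exact_subtype_mkQ I) Subtype.val_injective (Submodule.mkQ_surjective _)
  have : Epi (linHomPrecomp hI hR I.subtype Y) := hex.epi_g
  have hfac : linHomPrecomp hI hR I.subtype Y =
      linHomEv (RingHom.id R) hR Y 1 ≫ toLinHom hI Y := linHom_ext fun r => by
    rw [Category.assoc, toLinHom_ev, linHomPrecomp, linHomLift_ev, Linear.comp_smul,
      Category.comp_id, LinearMap.comp_apply, Submodule.subtype_apply]
    conv_lhs => rw [← mul_one (r : R), ← smul_eq_mul, map_smulₛₗ]
    rfl
  rw [hfac] at this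
  exact epi_of_epi (linHomEv (RingHom.id R) hR Y 1) _

/-! ### The exact sequence attached to an abelian deformation -/

section Sequence

variable {A R : Type*} [CommRing A] [CommRing R] {p : A →+* R}
  {B : Type u₁} [Category.{v₁} B] [Abelian B] [Linear A B]
  {C : Type u₂} [Category.{v₂} C] [Abelian C] [Linear R C]
  {ι : C ⥤ B} (h : IsDeformation p ι) (hp : Function.Surjective p) (hp' : (RingHom.ker p).FG)
  (hJ : Module.FinitePresentation A (RingHom.ker p))

/-- The morphism `Hom_A(R, Y) ⟶ Y`. -/
def homSEv (Y : B) : ι.obj ((homS h hp hp').obj Y) ⟶ Y := (homSAdj h hp hp').counit.app Y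

theorem homSEv_naturality {Y Z : B} (g : Y ⟶ Z) :
    ι.map ((homS h hp hp').map g) ≫ homSEv h hp hp' Z = homSEv h hp hp' Y ≫ g :=
  (homSAdj h hp hp').counit.naturality g

theorem exists_map_comp_homSEv {X : C} {Y : B} (u : ι.obj X ⟶ Y) :
    ∃ v : X ⟶ (homS h hp hp').obj Y, ι.map v ≫ homSEv h hp hp' Y = u :=
  ⟨(homSAdj h hp hp').homEquiv _ _ u, by
    have := (homSAdj h hp hp').homEquiv_counit (g := (homSAdj h hp hp').homEquiv _ _ u)
    rw [Equiv.symm_apply_apply] at this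
    exact this.symm⟩

instance (Y : B) : Mono (homSEv h hp hp' Y) := mono_homSAdj_counit h hp hp' Y

theorem map_comp_homSEv_injective {X : C} {Y : B} {u v : X ⟶ (homS h hp hp').obj Y}
    (huv : ι.map u ≫ homSEv h hp hp' Y = ι.map v ≫ homSEv h hp hp' Y) : u = v := by
  have := h.faithful
  exact ι.map_injective ((cancel_mono _).1 huv)

/-- The sequence `Hom_A(R, Y) ⟶ Y ⟶ Hom_A(J, Y)`, where `J` is the kernel of `A →+* R`. -/
@[simps]
def deformationShortComplex (Y : B) : ShortComplex B :=
  ShortComplex.mk (homSEv h hp hp' Y) (toLinHom hJ Y) (by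
    rw [comp_toLinHom_eq_zero_iff]
    intro r hr
    rw [← Category.id_comp (homSEv h hp hp' Y), ← Linear.smul_comp,
      h.smul_eq_zero _ (𝟙 _) r hr, zero_comp])

/-- The kernel of `Y ⟶ Hom_A(J, Y)` is annihilated by `J`, so it lies in the image of `ι` and its
inclusion factors through the counit. -/
theorem deformationShortComplex_exact (Y : B) :
    (deformationShortComplex h hp hp' hJ Y).Exact := by
  have : Mono (deformationShortComplex h hp hp' hJ Y).f :=
    inferInstanceAs (Mono (homSEv h hp hp' Y))
  have hK : ι.essImage (kernel (toLinHom hJ Y)) :=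
    h.mem_essImage (isSObject_of_smul_eq_zero hp fun r hr => by
      rw [← cancel_mono (kernel.ι (toLinHom hJ Y)), Linear.smul_comp, Category.id_comp, zero_comp]
      exact (comp_toLinHom_eq_zero_iff hJ _).1 (kernel.condition _) r hr)
  refine ShortComplex.exact_of_f_is_kernel _ (KernelFork.IsLimit.ofι' _ _ fun {X} u hu => ?_)
  have e := hK.getIso
  let v := (exists_map_comp_homSEv h hp hp' (e.hom ≫ kernel.ι (toLinHom hJ Y))).choose
  have hv := (exists_map_comp_homSEv h hp hp' (e.hom ≫ kernel.ι (toLinHom hJ Y))).choose_spec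
  refine ⟨kernel.lift _ u hu ≫ e.inv ≫ ι.map v, ?_⟩
  dsimp only [deformationShortComplex]
  rw [Category.assoc, Category.assoc, hv, e.inv_hom_id_assoc]
  exact kernel.lift_ι _ _ _

theorem deformationShortComplex_shortExact (Y : B) (hY : Epi (toLinHom hJ Y)) :
    (deformationShortComplex h hp hp' hJ Y).ShortExact :=
  { exact := deformationShortComplex_exact h hp hp' hJ Y
    mono_f := inferInstanceAs (Mono (homSEv h hp hp' Y))
    epi_g := hY }

/-- The morphism `Hom_R(J, Hom_A(R, Y)) ⟶ Hom_A(J, Y)`. -/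
def linHomComparison (Y : B) :
    ι.obj (linHom p hJ ((homS h hp hp').obj Y)) ⟶ linHom (RingHom.id A) hJ Y :=
  linHomLift
    { toFun := fun m => ι.map (linHomEv p hJ ((homS h hp hp').obj Y) m) ≫ homSEv h hp hp' Y
      map_add' := fun m n => by rw [map_add, h.linear.map_add, Preadditive.add_comp]
      map_smul' := fun a m => by
        rw [map_smulₛₗ, h.linear.map_smul, Linear.smul_comp, RingHom.id_apply] }

theorem linHomComparison_ev (Y : B) (m : RingHom.ker p) :
    linHomComparison h hp hp' hJ Y ≫ linHomEv (RingHom.id A) hJ Y m =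
      ι.map (linHomEv p hJ ((homS h hp hp').obj Y) m) ≫ homSEv h hp hp' Y :=
  linHomLift_ev _ m

theorem linHomComparison_naturality {Y Z : B} (g : Y ⟶ Z) :
    ι.map (linHomMap p hJ ((homS h hp hp').map g)) ≫ linHomComparison h hp hp' hJ Z =
      linHomComparison h hp hp' hJ Y ≫ linHomMap (RingHom.id A) hJ g :=
  linHom_ext fun m => by
    rw [Category.assoc, Category.assoc, linHomComparison_ev, linHomMap_ev,
      reassoc_of% linHomComparison_ev h hp hp' hJ Y m, ← ι.map_comp_assoc, linHomMap_ev,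
      ι.map_comp_assoc,
      homSEv_naturality]

/-- Because `J ^ 2 = 0`, the object `Hom_A(J, Y)` is an `R`-object, so its evaluations factor
through `Hom_A(R, Y)`. These factorizations assemble to the inverse. -/
theorem isIso_linHomComparison (hJJ : RingHom.ker p * RingHom.ker p = ⊥) (Y : B) :
    IsIso (linHomComparison h hp hp' hJ Y) := by
  have := h.full
  have hK : ι.essImage (linHom (RingHom.id A) hJ Y) :=
    h.mem_essImage (isSObject_of_smul_eq_zero hp fun r hr => linHom_ext fun m => by
      have h0 : r • m = 0 := Subtype.ext (by
        have := Ideal.mul_mem_mul (show r ∈ RingHom.ker p from hr) m.2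
        rwa [hJJ] at this)
      have h1 := map_smulₛₗ (linHomEv (RingHom.id A) hJ Y) r m
      rw [h0, map_zero] at h1
      rw [Linear.smul_comp, Category.id_comp, zero_comp]
      exact h1.symm)
  have e := hK.getIso
  choose φ hφ using fun m : RingHom.ker p =>
    exists_map_comp_homSEv h hp hp' (e.hom ≫ linHomEv (RingHom.id A) hJ Y m)
  let u : hK.witness ⟶ linHom p hJ ((homS h hp hp').obj Y) := linHomLift
    { toFun := φ
      map_add' := fun m n => map_comp_homSEv_injective h hp hp' (by
        rw [h.linear.map_add, Preadditive.add_comp, hφ, hφ, hφ, map_add, Preadditive.comp_add])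
      map_smul' := fun a m => map_comp_homSEv_injective h hp hp' (by
        rw [h.linear.map_smul, Linear.smul_comp, hφ, hφ, map_smulₛₗ, Linear.comp_smul]
        rfl) }
  have hu : ∀ m, u ≫ linHomEv p hJ _ m = φ m := linHomLift_ev _
  have h1 : (e.inv ≫ ι.map u) ≫ linHomComparison h hp hp' hJ Y = 𝟙 _ := linHom_ext fun m => by
    rw [Category.assoc, Category.assoc, linHomComparison_ev, ← ι.map_comp_assoc, hu, hφ,
      e.inv_hom_id_assoc, Category.id_comp]
  refine ⟨e.inv ≫ ι.map u, ?_, h1⟩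
  -- By fullness the other composite is `ι.map v`, and `v` can be compared with the identity on
  -- evaluations.
  obtain ⟨v, hv⟩ := ι.map_surjective (linHomComparison h hp hp' hJ Y ≫ e.inv ≫ ι.map u)
  have : v = 𝟙 _ := linHom_ext fun m => map_comp_homSEv_injective h hp hp' (by
    rw [ι.map_comp, hv, Category.id_comp, ← linHomComparison_ev, Category.assoc,
      ← linHomComparison_ev, ← Category.assoc,
      Category.assoc _ _ (linHomComparison h hp hp' hJ Y), h1, Category.comp_id])
  rw [← hv, this, ι.map_id]

end Sequence

/-! ### Two successive deformations and the condition `I J = 0` -/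

section Composite

variable {A R S : Type*} [CommRing A] [CommRing R] [CommRing S] {p : A →+* R} {q : R →+* S}
  {B : Type u₁} [Category.{v₁} B] [Abelian B] [Linear A B]
  {C : Type u₂} [Category.{v₂} C] [Abelian C] [Linear R C]
  {D : Type u₃} [Category.{v₃} D] [Abelian D] [Linear S D]
  {ιb : C ⥤ B} {ι : D ⥤ C} (hιb : IsDeformation p ιb) (hι : IsDeformation q ι)
  (hp : Function.Surjective p) (hq : Function.Surjective q)
  (hp' : (RingHom.ker p).FG) (hq' : (RingHom.ker q).FG)
  (hA : IsCoherentRing A)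
  (hIJ : RingHom.ker (q.comp p) * RingHom.ker p = ⊥)

include hIJ in
theorem ker_mul_ker_eq_bot : RingHom.ker p * RingHom.ker p = ⊥ := by
  rw [← le_bot_iff, ← hIJ]
  exact Ideal.mul_mono_left fun r hr => by
    rw [RingHom.mem_ker] at hr ⊢
    rw [RingHom.comp_apply, hr, map_zero]

include hp hIJ in
-- An element of `ker q` lifts along `p` to an element of `I`, which kills `J`. Thus `Hom_R(J, W)`
-- lies in the essential image of the fully faithful `ι`, where the counit is invertible.
theorem isIso_homSEv_linHom (W : C) :
    IsIso (homSEv hι hq hq' (linHom p (hA _ hp') W)) := by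
  have := hι.full
  have := hι.faithful
  refine ((homSAdj hι hq hq').isIso_counit_app_iff_mem_essImage).2
    (hι.mem_essImage (isSObject_of_smul_eq_zero hq fun r hr => linHom_ext fun m => ?_))
  obtain ⟨a, rfl⟩ := hp r
  have h0 : a • m = 0 := Subtype.ext (by
    have := Ideal.mul_mem_mul (show a ∈ RingHom.ker (q.comp p) from hr) m.2
    rwa [hIJ] at this)
  have h1 := map_smulₛₗ (linHomEv p (hA _ hp') W) a m
  rw [h0, map_zero] at h1
  rw [Linear.smul_comp, Category.id_comp, zero_comp]
  exact h1.symm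

theorem homJComparison_naturality (hJ : Module.FinitePresentation A (RingHom.ker p))
    {Y Z : B} (g : Y ⟶ Z) :
    ιb.map (ι.map ((homS hι hq hq').map (linHomMap p hJ ((homS hιb hp hp').map g)))) ≫
        ιb.map (homSEv hι hq hq' _) ≫ linHomComparison hιb hp hp' hJ Z =
      (ιb.map (homSEv hι hq hq' _) ≫ linHomComparison hιb hp hp' hJ Y) ≫
        linHomMap (RingHom.id A) hJ g := by
  rw [← ιb.map_comp_assoc, homSEv_naturality, ιb.map_comp_assoc, Category.assoc,
    linHomComparison_naturality]

/-- The objects `Hom_R(J, Hom_A(R, Y))` of `D` and `Hom_A(J, Y)` of `B` agree. -/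
def homJIso : homS hιb hp hp' ⋙ homJ p hA hp' hι hq hq' ⋙ ι ⋙ ιb ≅
    linHomFunctor (RingHom.id A) B (hA _ hp') :=
  NatIso.ofComponents
    (fun Y =>
      ιb.mapIso (@asIso _ _ _ _ _
        (isIso_homSEv_linHom hι hp hq hp' hq' hA hIJ ((homS hιb hp hp').obj Y))) ≪≫
        @asIso _ _ _ _ _
          (isIso_linHomComparison hιb hp hp' (hA _ hp') (ker_mul_ker_eq_bot hIJ) Y))
    (fun g => homJComparison_naturality hιb hι hp hq hp' hq' (hA _ hp') g)

end Composite

/-! ### Exact functors and derived adjunctions on bounded below derived categories -/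

section MapHomotopyCategoryPlus

variable {C D : Type*} [Category* C] [Category* D] [Preadditive C] [Preadditive D]

/-- An adjunction induces an adjunction between categories of homological complexes. -/
def mapHomologicalComplexAdj {G : C ⥤ D} {F : D ⥤ C} [G.Additive] [F.Additive] (adj : G ⊣ F)
    {i : Type*} (c : ComplexShape i) : G.mapHomologicalComplex c ⊣ F.mapHomologicalComplex c where
  unit :=
    { app := fun K =>
        { f := fun n => adj.unit.app (K.X n)
          comm' := fun m n _ => (adj.unit.naturality (K.d m n)).symm }
      naturality := fun K L f => by
        ext n
        exact adj.unit.naturality (f.f n) }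
  counit :=
    { app := fun K =>
        { f := fun n => adj.counit.app (K.X n)
          comm' := fun m n _ => (adj.counit.naturality (K.d m n)).symm }
      naturality := fun K L f => by
        ext n
        exact adj.counit.naturality (f.f n) }
  left_triangle_components K := by
    ext n
    exact adj.left_triangle_components (K.X n)
  right_triangle_components K := by
    ext n
    exact adj.right_triangle_components (K.X n)

/-- An adjunction induces an adjunction between bounded below homotopy categories. -/
def mapHomotopyCategoryPlusAdj {G : C ⥤ D} {F : D ⥤ C} [G.Additive] [F.Additive] (adj : G ⊣ F) :
    G.mapHomotopyCategoryPlus ⊣ F.mapHomotopyCategoryPlus where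
  unit :=
    { app := fun K => ObjectProperty.homMk ((HomotopyCategory.quotient _ _).map
        ((mapHomologicalComplexAdj adj (.up ℤ)).unit.app K.obj.as))
      naturality := fun K L f => by
        obtain ⟨f, rfl⟩ := ObjectProperty.homMk_surjective f
        obtain ⟨f, rfl⟩ := (HomotopyCategory.quotient _ _).map_surjective f
        ext
        exact congrArg (HomotopyCategory.quotient _ _).map
          ((mapHomologicalComplexAdj adj (.up ℤ)).unit.naturality f) }
  counit :=
    { app := fun K => ObjectProperty.homMk ((HomotopyCategory.quotient _ _).map
        ((mapHomologicalComplexAdj adj (.up ℤ)).counit.app K.obj.as))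
      naturality := fun K L f => by
        obtain ⟨f, rfl⟩ := ObjectProperty.homMk_surjective f
        obtain ⟨f, rfl⟩ := (HomotopyCategory.quotient _ _).map_surjective f
        ext
        exact congrArg (HomotopyCategory.quotient _ _).map
          ((mapHomologicalComplexAdj adj (.up ℤ)).counit.naturality f) }
  left_triangle_components K := by
    ext
    exact congrArg (HomotopyCategory.quotient _ _).map
      ((mapHomologicalComplexAdj adj (.up ℤ)).left_triangle_components K.obj.as)
  right_triangle_components K := by
    ext
    exact congrArg (HomotopyCategory.quotient _ _).map
      ((mapHomologicalComplexAdj adj (.up ℤ)).right_triangle_components K.obj.as)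

end MapHomotopyCategoryPlus

/-! ### Derived functors of exact functors and the derived adjunction -/

section ExactFunctor

variable {C D : Type*} [Category* C] [Category* D] [Abelian C] [Abelian D]
  [HasDerivedCategory C] [HasDerivedCategory D]
  (G : C ⥤ D) [G.Additive] [PreservesFiniteLimits G] [PreservesFiniteColimits G]

/-- The claim is transferred from the unbounded derived category along the fully faithful inclusion.
-/
theorem quasiIso_isInvertedBy_mapHomotopyCategoryPlus :
    (HomotopyCategory.Plus.quasiIso C).IsInvertedBy
      (G.mapHomotopyCategoryPlus ⋙ DerivedCategory.Plus.Qh) := fun K L f hf => by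
  have h1 : IsIso (DerivedCategory.Qh.map f.hom) :=
    Localization.inverts DerivedCategory.Qh (HomotopyCategory.quasiIso C (.up ℤ)) _ hf
  have h2 := (NatIso.isIso_map_iff G.mapDerivedCategoryFactorsh f.hom).1
    (inferInstanceAs (IsIso (G.mapDerivedCategory.map (DerivedCategory.Qh.map f.hom))))
  have h3 : IsIso (DerivedCategory.Plus.ι.map
      ((G.mapHomotopyCategoryPlus ⋙ DerivedCategory.Plus.Qh).map f)) := h2
  exact isIso_of_fully_faithful DerivedCategory.Plus.ι _

/-- The functor on bounded below derived categories induced by an exact functor. -/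
def mapDerivedCategoryPlus : DerivedCategory.Plus C ⥤ DerivedCategory.Plus D :=
  Localization.lift (G.mapHomotopyCategoryPlus ⋙ DerivedCategory.Plus.Qh)
    (quasiIso_isInvertedBy_mapHomotopyCategoryPlus G) DerivedCategory.Plus.Qh

instance : Localization.Lifting DerivedCategory.Plus.Qh (HomotopyCategory.Plus.quasiIso C)
    (G.mapHomotopyCategoryPlus ⋙ DerivedCategory.Plus.Qh) (mapDerivedCategoryPlus G) :=
  inferInstanceAs (Localization.Lifting _ _ _ (Localization.lift _ _ _))

/-- `mapDerivedCategoryPlus G` is induced by `G.mapHomotopyCategoryPlus`. -/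
def mapDerivedCategoryPlusFactors :
    DerivedCategory.Plus.Qh ⋙ mapDerivedCategoryPlus G ≅
      G.mapHomotopyCategoryPlus ⋙ DerivedCategory.Plus.Qh :=
  Localization.Lifting.iso DerivedCategory.Plus.Qh (HomotopyCategory.Plus.quasiIso C) _ _

instance : (mapDerivedCategoryPlus G).CommShift ℤ :=
  Functor.commShiftOfLocalization DerivedCategory.Plus.Qh
    (HomotopyCategory.Plus.quasiIso C) ℤ
    (G.mapHomotopyCategoryPlus ⋙ DerivedCategory.Plus.Qh) (mapDerivedCategoryPlus G)

instance : (mapDerivedCategoryPlus G).Additive := by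
  rw [Localization.functor_additive_iff DerivedCategory.Plus.Qh
    (HomotopyCategory.Plus.subcategoryAcyclic C).trW]
  exact Functor.additive_of_iso (mapDerivedCategoryPlusFactors G).symm

instance : (mapDerivedCategoryPlus G).IsLeftDerivedFunctor
    (mapDerivedCategoryPlusFactors G).hom (HomotopyCategory.Plus.quasiIso C) :=
  Functor.isLeftDerivedFunctor_of_inverts _ _ _

variable {G} {F : D ⥤ C} [F.Additive] [EnoughInjectives D] (adj : G ⊣ F)

/-- The derived adjunction needs both composites to be derived functors. Here this is tested on
complexes of injectives, where the unit of the derived functor is invertible. -/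
instance : (F.rightDerivedFunctorPlus ⋙ mapDerivedCategoryPlus G).IsRightDerivedFunctor
    (Functor.whiskerRight F.rightDerivedFunctorPlusUnit (mapDerivedCategoryPlus G) ≫
      (Functor.associator _ _ _).hom) (HomotopyCategory.Plus.quasiIso D) := by
  refine LocalizerMorphism.Derives.isRightDerivedFunctor_of_isIso
    (Φ := HomotopyCategory.Plus.localizerMorphism D)
    (HomotopyCategory.Plus.localizerMorphism_derives _) _ fun X => ?_
  have : IsIso (F.rightDerivedFunctorPlusUnit.app
      ((InjectiveObject.ι D).mapHomotopyCategoryPlus.obj X)) := inferInstance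
  dsimp
  infer_instance

instance : (mapDerivedCategoryPlus G ⋙ F.rightDerivedFunctorPlus).IsLeftDerivedFunctor
    ((Functor.associator _ _ _).inv ≫ Functor.whiskerRight (mapDerivedCategoryPlusFactors G).hom
      F.rightDerivedFunctorPlus) (HomotopyCategory.Plus.quasiIso C) :=
  Functor.isLeftDerivedFunctor_of_inverts _ _
    ((Functor.associator _ _ _).symm ≪≫ Functor.isoWhiskerRight (mapDerivedCategoryPlusFactors G)
      F.rightDerivedFunctorPlus)

/-- The derived adjunction of an exact functor and its right adjoint. -/
def derivedPlusAdj : mapDerivedCategoryPlus G ⊣ F.rightDerivedFunctorPlus :=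
  (mapHomotopyCategoryPlusAdj adj).derived (HomotopyCategory.Plus.quasiIso C)
    (HomotopyCategory.Plus.quasiIso D) (mapDerivedCategoryPlusFactors G).hom
    F.rightDerivedFunctorPlusUnit

theorem derivedPlusAdj_counit_fac (K : HomotopyCategory.Plus D) :
    (mapDerivedCategoryPlus G).map (F.rightDerivedFunctorPlusUnit.app K) ≫
        (derivedPlusAdj adj).counit.app (DerivedCategory.Plus.Qh.obj K) =
      (mapDerivedCategoryPlusFactors G).hom.app (F.mapHomotopyCategoryPlus.obj K) ≫
        DerivedCategory.Plus.Qh.map ((mapHomotopyCategoryPlusAdj adj).counit.app K) := by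
  have := (mapHomotopyCategoryPlusAdj adj).derivedε_fac_app
    (HomotopyCategory.Plus.quasiIso D) (mapDerivedCategoryPlusFactors G).hom
    F.rightDerivedFunctorPlusUnit K
  exact this

/-- On an object where `F` needs no further resolution, the derived counit is represented by the
counit of complexes. This lets a short exact sequence of complexes compute its cone. -/
theorem derivedPlusAdj_counit_comp {K : HomotopyCategory.Plus D} {Z : DerivedCategory.Plus D}
    (e : Z ⟶ DerivedCategory.Plus.Qh.obj K) [IsIso (F.rightDerivedFunctorPlusUnit.app K)] :
    (derivedPlusAdj adj).counit.app Z ≫ e =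
      ((mapDerivedCategoryPlus G).map
        (F.rightDerivedFunctorPlus.map e ≫ inv (F.rightDerivedFunctorPlusUnit.app K)) ≫
          (mapDerivedCategoryPlusFactors G).hom.app (F.mapHomotopyCategoryPlus.obj K)) ≫
        DerivedCategory.Plus.Qh.map ((mapHomotopyCategoryPlusAdj adj).counit.app K) := by
  have h1 : _ = (derivedPlusAdj adj).counit.app Z ≫ e :=
    (derivedPlusAdj adj).counit.naturality e
  rw [← h1, Category.assoc, ← derivedPlusAdj_counit_fac, ← Functor.map_comp_assoc,
    Category.assoc, IsIso.inv_hom_id, Category.comp_id]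
  rfl

end ExactFunctor

/-! ### The triangle attached to an abelian deformation -/

open Pretriangulated

theorem nonempty_obj₃_iso_of_distinguished {T : Type*} [Category* T] [HasZeroObject T]
    [HasShift T ℤ] [Preadditive T] [∀ n : ℤ, (shiftFunctor T n).Additive] [Pretriangulated T]
    {T₁ T₂ : Triangle T} (h₁ : T₁ ∈ distTriang T) (h₂ : T₂ ∈ distTriang T)
    (e₁ : T₁.obj₁ ≅ T₂.obj₁) (e₂ : T₁.obj₂ ≅ T₂.obj₂)
    (comm : T₁.mor₁ ≫ e₂.hom = e₁.hom ≫ T₂.mor₁) : Nonempty (T₁.obj₃ ≅ T₂.obj₃) :=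
  ⟨Triangle.π₃.mapIso (isoTriangleOfIso₁₂ T₁ T₂ h₁ h₂ e₁ e₂ comm)⟩

section

variable {B : Type*} [Category* B] [Abelian B] [HasDerivedCategory B]

variable (B) in
/-- The functor `DerivedCategory.Plus.Q` is induced by `DerivedCategory.Q`. -/
def plusQCompιIso : DerivedCategory.Plus.Q ⋙ DerivedCategory.Plus.ι ≅
    CochainComplex.Plus.ι B ⋙ DerivedCategory.Q :=
  Functor.isoWhiskerLeft (CochainComplex.Plus.ι B) (DerivedCategory.quotientCompQhIso B)

/-- The comparison takes place in the unbounded derived category, where a short exact sequence of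
complexes yields a distinguished triangle; the inclusion of `D^+` is fully faithful. -/
theorem nonempty_obj₃_iso_of_shortExact {K₁ K₂ K₃ : CochainComplex.Plus B}
    (f : K₁ ⟶ K₂) (g : K₂.obj ⟶ K₃.obj) (w : f.hom ≫ g = 0)
    (hS : (ShortComplex.mk f.hom g w).ShortExact)
    {T : Triangle (DerivedCategory.Plus B)} (hT : T ∈ distTriang (DerivedCategory.Plus B))
    (e₁ : T.obj₁ ≅ DerivedCategory.Plus.Q.obj K₁) (e₂ : T.obj₂ ≅ DerivedCategory.Plus.Q.obj K₂)
    (comm : T.mor₁ ≫ e₂.hom = e₁.hom ≫ DerivedCategory.Plus.Q.map f) :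
    Nonempty (T.obj₃ ≅ DerivedCategory.Plus.Q.obj K₃) := by
  obtain ⟨e⟩ := nonempty_obj₃_iso_of_distinguished
    (DerivedCategory.Plus.ι.map_distinguished T hT)
    (DerivedCategory.triangleOfSES_distinguished hS)
    (DerivedCategory.Plus.ι.mapIso e₁ ≪≫ (plusQCompιIso B).app K₁)
    (DerivedCategory.Plus.ι.mapIso e₂ ≪≫ (plusQCompιIso B).app K₂) (by
      have h1 := DerivedCategory.Plus.ι.congr_map comm
      have h2 := (plusQCompιIso B).hom.naturality f
      rw [Functor.map_comp, Functor.map_comp] at h1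
      change DerivedCategory.Plus.ι.map T.mor₁ ≫ DerivedCategory.Plus.ι.map e₂.hom ≫
          (plusQCompιIso B).hom.app K₂ =
        (DerivedCategory.Plus.ι.map e₁.hom ≫ (plusQCompιIso B).hom.app K₁) ≫
          (CochainComplex.Plus.ι B ⋙ DerivedCategory.Q).map f
      rw [Category.assoc, ← h2, Functor.comp_map, reassoc_of% h1])
  exact ⟨DerivedCategory.Plus.ι.preimageIso (e ≪≫ ((plusQCompιIso B).app K₃).symm)⟩

theorem exists_injective_complex [EnoughInjectives B] (Z : DerivedCategory.Plus B) :
    ∃ E : CochainComplex.Plus B, (∀ n, Injective (E.obj.X n)) ∧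
      Nonempty (DerivedCategory.Plus.Q.obj E ≅ Z) := by
  obtain ⟨E, ⟨e⟩⟩ := Functor.EssSurj.mem_essImage
    (F := (InjectiveObject.ι B).mapHomotopyCategoryPlus ⋙ DerivedCategory.Plus.Qh) Z
  obtain ⟨E, rfl⟩ := HomotopyCategory.Plus.quotient_obj_surjective E
  exact ⟨(InjectiveObject.ι B).mapCochainComplexPlus.obj E,
    fun n => (E.obj.X n).property, ⟨e⟩⟩

end

/-! ### The cone of the derived counit -/

section Composite

variable {A R S : Type*} [CommRing A] [CommRing R] [CommRing S] {p : A →+* R} {q : R →+* S}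
  {B : Type*} [Category* B] [Abelian B] [Linear A B] [EnoughInjectives B]
  {C : Type*} [Category* C] [Abelian C] [Linear R C] [EnoughInjectives C]
  {D : Type*} [Category* D] [Abelian D] [Linear S D]
  [HasDerivedCategory B] [HasDerivedCategory C] [HasDerivedCategory D]
  {ιb : C ⥤ B} {ι : D ⥤ C} (hιb : IsDeformation p ιb) (hι : IsDeformation q ι)
  (hp : Function.Surjective p) (hq : Function.Surjective q)
  (hp' : (RingHom.ker p).FG) (hq' : (RingHom.ker q).FG)
  (hA : IsCoherentRing A)
  (hIJ : RingHom.ker (q.comp p) * RingHom.ker p = ⊥)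

variable [ιb.Additive] [PreservesFiniteLimits ιb] [PreservesFiniteColimits ιb]
  [ι.Additive] [PreservesFiniteLimits ι] [PreservesFiniteColimits ι]

include hIJ in
theorem nonempty_obj₃_iso_RHomJ (hB : IsFlatAbelian A B) (Z : DerivedCategory.Plus B)
    {K : DerivedCategory.Plus B} (g : Z ⟶ K)
    (δ : K ⟶ ((mapDerivedCategoryPlus ιb).obj ((RHomS hιb hp hp').obj Z))⟦(1 : ℤ)⟧)
    (hT : Triangle.mk ((derivedPlusAdj (homSAdj hιb hp hp')).counit.app Z) g δ ∈
      distTriang (DerivedCategory.Plus B)) :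
    Nonempty (K ≅ (mapDerivedCategoryPlus ιb).obj ((mapDerivedCategoryPlus ι).obj
      ((RHomJ p hA hp' hι hq hq').obj ((RHomS hιb hp hp').obj Z)))) := by
  obtain ⟨E, hE, ⟨e⟩⟩ := exists_injective_complex Z
  let E₁ : CochainComplex.Plus C := (homS hιb hp hp').mapCochainComplexPlus.obj E
  have hE₁ : ∀ n, Injective (E₁.obj.X n) := fun n =>
    @injective_homS _ _ _ _ _ _ _ _ _ _ _ _ _ _ hιb hp hp' (E.obj.X n) (hE n)
  let β := (homS hιb hp hp').rightDerivedFunctorPlusUnit.app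
    ((HomotopyCategory.Plus.quotient B).obj E)
  let γ := (homJ p hA hp' hι hq hq').rightDerivedFunctorPlusUnit.app
    ((HomotopyCategory.Plus.quotient C).obj E₁)
  -- `E` and `E₁` are degreewise injective, so both functors are computed on them without further
  -- resolution.
  have hβ : IsIso β := inferInstance
  have hγ : IsIso γ := inferInstance
  let L₂ : CochainComplex.Plus B :=
    (linHomFunctor (RingHom.id A) B (hA _ hp')).mapCochainComplexPlus.obj E
  let ε : ιb.mapCochainComplexPlus.obj E₁ ⟶ E := ObjectProperty.homMk
    ((mapHomologicalComplexAdj (homSAdj hιb hp hp') (.up ℤ)).counit.app E.obj)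
  let τ : E.obj ⟶ L₂.obj :=
    { f := fun n => toLinHom (hA _ hp') (E.obj.X n)
      comm' := fun m n _ => (toLinHom_naturality (hA _ hp') (E.obj.d m n)).symm }
  have hw : ε.hom ≫ τ = 0 := by
    ext n
    exact (deformationShortComplex hιb hp hp' (hA _ hp') (E.obj.X n)).zero
  have hS : (ShortComplex.mk ε.hom τ hw).ShortExact :=
    HomologicalComplex.shortExact_of_degreewise_shortExact _ fun n =>
      deformationShortComplex_shortExact hιb hp hp' (hA _ hp') (E.obj.X n)
        (IsCoflat.epi_toLinHom _ hp' (hB _ (hE n)))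
  obtain ⟨i⟩ := nonempty_obj₃_iso_of_shortExact ε τ hw hS hT
    ((mapDerivedCategoryPlus ιb).mapIso
        ((RHomS hιb hp hp').mapIso e.symm ≪≫ (@asIso _ _ _ _ β hβ).symm) ≪≫
      (mapDerivedCategoryPlusFactors ιb).app _) e.symm
      (derivedPlusAdj_counit_comp (homSAdj hιb hp hp') e.inv)
  let j : (homS hιb hp hp' ⋙ homJ p hA hp' hι hq hq' ⋙ ι ⋙ ιb).mapCochainComplexPlus.obj E ≅ L₂ :=
    (CochainComplex.Plus.ι B).preimageIso
      ((NatIso.mapHomologicalComplex (homJIso hιb hι hp hq hp' hq' hA hIJ) (.up ℤ)).app E.obj)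
  let k : DerivedCategory.Plus.Q.obj
      ((homS hιb hp hp' ⋙ homJ p hA hp' hι hq hq' ⋙ ι ⋙ ιb).mapCochainComplexPlus.obj E) ≅
      (mapDerivedCategoryPlus ιb).obj ((mapDerivedCategoryPlus ι).obj
        (DerivedCategory.Plus.Q.obj
          ((homJ p hA hp' hι hq hq').mapCochainComplexPlus.obj E₁))) :=
    ((mapDerivedCategoryPlusFactors ιb).app ((HomotopyCategory.Plus.quotient C).obj
      (ι.mapCochainComplexPlus.obj
        ((homJ p hA hp' hι hq hq').mapCochainComplexPlus.obj E₁)))).symm ≪≫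
      (mapDerivedCategoryPlus ιb).mapIso ((mapDerivedCategoryPlusFactors ι).app
        ((HomotopyCategory.Plus.quotient D).obj
          ((homJ p hA hp' hι hq hq').mapCochainComplexPlus.obj E₁))).symm
  exact ⟨i ≪≫ DerivedCategory.Plus.Q.mapIso j.symm ≪≫ k ≪≫ (mapDerivedCategoryPlus ιb).mapIso
    ((mapDerivedCategoryPlus ι).mapIso (@asIso _ _ _ _ γ hγ ≪≫ (RHomJ p hA hp' hι hq hq').mapIso
      (@asIso _ _ _ _ β hβ ≪≫ (RHomS hιb hp hp').mapIso e)))⟩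

end Composite

/-! ### Obstructions to lifts along a right adjoint -/

section Obstruction

variable {T : Type*} [Category* T] [HasZeroObject T] [HasShift T ℤ] [Preadditive T]
  [∀ n : ℤ, (shiftFunctor T n).Additive] [Pretriangulated T]
  {T' : Type*} [Category* T'] [HasShift T' ℤ] [Preadditive T']
  {G : T' ⥤ T} {F : T ⥤ T'} (adj : G ⊣ F) [G.Additive] [G.CommShift ℤ]
  {X Y : T'} (x : ObjLift F X) (y : ObjLift F Y)

/-- The morphism `G(F x) ⟶ y` adjoint to a morphism between objects with lifts `x`, `y`. -/
def adjointOfLift : (X ⟶ Y) →+ (G.obj (F.obj x.obj) ⟶ y.obj) where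
  toFun f := G.map (x.iso.inv ≫ f ≫ y.iso.hom) ≫ adj.counit.app y.obj
  map_zero' := by simp
  map_add' f g := by simp

omit [HasZeroObject T] [HasShift T ℤ] [∀ n : ℤ, (shiftFunctor T n).Additive]
  [Pretriangulated T] [HasShift T' ℤ] [G.CommShift ℤ] in
-- Both sides are adjuncts of each other, by naturality of the counit.
theorem isLift_iff_counit_comp_eq (f : X ⟶ Y) (g : x.obj ⟶ y.obj) :
    x.iso.hom ≫ F.map g = f ≫ y.iso.hom ↔
      adj.counit.app x.obj ≫ g = adjointOfLift adj x y f := by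
  have h1 : G.map (F.map g) ≫ adj.counit.app y.obj = adj.counit.app x.obj ≫ g :=
    adj.counit.naturality g
  rw [← h1, ← Iso.eq_inv_comp]
  refine ⟨fun h => by rw [h]; rfl, fun h => (adj.homEquiv _ _).symm.injective ?_⟩
  rw [Adjunction.homEquiv_counit, Adjunction.homEquiv_counit]
  exact h

variable {K : T} {g : x.obj ⟶ K} {δ : K ⟶ (G.obj (F.obj x.obj))⟦(1 : ℤ)⟧}
  (hT : Triangle.mk (adj.counit.app x.obj) g δ ∈ distTriang T)

include hT in
omit [HasShift T' ℤ] [G.CommShift ℤ] in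
theorem nonempty_mapLift_iff (f : X ⟶ Y) :
    Nonempty (MapLift f x y) ↔ δ ≫ (adjointOfLift adj x y f)⟦(1 : ℤ)⟧' = 0 := by
  constructor
  · rintro ⟨u, hu⟩
    have h1 : δ ≫ (adj.counit.app x.obj)⟦(1 : ℤ)⟧' = 0 := comp_distTriang_mor_zero₃₁ _ hT
    rw [← (isLift_iff_counit_comp_eq adj x y f u).1 hu, Functor.map_comp, reassoc_of% h1,
      zero_comp]
  · intro h
    -- The last map of the rotated triangle is minus the shifted counit, whence the sign in the lift
    -- `-v`.
    obtain ⟨u, hu⟩ := Triangle.yoneda_exact₃ _ (rot_of_distTriang _ hT)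
      ((adjointOfLift adj x y f)⟦(1 : ℤ)⟧') h
    change x.obj⟦(1 : ℤ)⟧ ⟶ y.obj⟦(1 : ℤ)⟧ at u
    obtain ⟨v, rfl⟩ := (shiftFunctor T (1 : ℤ)).map_surjective u
    refine ⟨-v, (isLift_iff_counit_comp_eq adj x y f _).2
      ((shiftFunctor T (1 : ℤ)).map_injective ?_)⟩
    refine Eq.trans ?_ hu.symm
    rw [Preadditive.comp_neg, Functor.map_neg, Functor.map_comp]
    exact (Preadditive.neg_comp _ _).symm

include hT in
-- Such a `b` factors through `δ` by a morphism `G(F x)[1] ⟶ y`. Adjunction and compatibility of `G`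
-- with shifts turn the latter into an element of `Ext^{-1}(X, Y)`.
theorem comp_left_injective_of_subsingleton [∀ n : ℤ, (shiftFunctor T' n).Additive]
    (h : Subsingleton (ShiftedHom X Y (-1 : ℤ))) (b : K ⟶ y.obj) (hb : g ≫ b = 0) : b = 0 := by
  obtain ⟨c, rfl⟩ := Triangle.yoneda_exact₃ _ hT b hb
  change (G.obj (F.obj x.obj))⟦(1 : ℤ)⟧ ⟶ y.obj at c
  obtain ⟨v, hv⟩ := (adj.homEquiv ((F.obj x.obj)⟦(1 : ℤ)⟧) y.obj).symm.surjective
    ((G.commShiftIso (1 : ℤ)).hom.app (F.obj x.obj) ≫ c)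
  have hv0 : v = 0 := by
    -- Shifting `v : (F x)[1] ⟶ F y` by `-1` and using the comparison isomorphisms gives a morphism
    -- `X ⟶ Y[-1]`.
    let s : ShiftedHom X Y (-1 : ℤ) := x.iso.hom ≫
      (shiftShiftNeg (F.obj x.obj) (1 : ℤ)).inv ≫ v⟦(-1 : ℤ)⟧' ≫ y.iso.inv⟦(-1 : ℤ)⟧'
    have hs : s = 0 := Subsingleton.elim _ _
    rw [Preadditive.IsIso.comp_left_eq_zero, Preadditive.IsIso.comp_left_eq_zero,
      Preadditive.IsIso.comp_right_eq_zero] at hs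
    exact (shiftFunctor T' (-1 : ℤ)).map_injective (hs.trans (Functor.map_zero _ _ _).symm)
  rw [Adjunction.homEquiv_counit, hv0, G.map_zero, zero_comp] at hv
  have hc : c = 0 := by
    rw [← cancel_epi ((G.commShiftIso (1 : ℤ)).hom.app (F.obj x.obj)), ← hv, comp_zero]
  rw [hc]
  exact comp_zero

/-- If `t : H →+ (x ⟶ y)` is injective with image the morphisms killed by precomposition with the
counit, then the non-empty sets of lifts are torsors under `H`. -/
@[reducible]
def mapLiftAddTorsor {H : Type*} [AddCommGroup H] (t : H →+ (x.obj ⟶ y.obj))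
    (ht : Function.Injective t)
    (ht' : ∀ u, adj.counit.app x.obj ≫ u = 0 ↔ u ∈ t.range) (f : X ⟶ Y)
    (hf : Nonempty (MapLift f x y)) : AddTorsor H (MapLift f x y) where
  vadd a u := ⟨u.1 + t a, (isLift_iff_counit_comp_eq adj x y f _).2 (by
    rw [Preadditive.comp_add, (ht' (t a)).2 ⟨a, rfl⟩, add_zero]
    exact (isLift_iff_counit_comp_eq adj x y f _).1 u.2)⟩
  zero_vadd u := Subtype.ext (by
    change u.1 + t 0 = u.1
    rw [map_zero, add_zero])
  add_vadd a b u := Subtype.ext (by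
    change u.1 + t (a + b) = u.1 + t b + t a
    rw [map_add]
    abel)
  vsub u v := ((ht' (u.1 - v.1)).1 (by
    rw [Preadditive.comp_sub, (isLift_iff_counit_comp_eq adj x y f _).1 u.2,
      (isLift_iff_counit_comp_eq adj x y f _).1 v.2, sub_self])).choose
  nonempty := hf
  vsub_vadd' u v := Subtype.ext (by
    have := ((ht' (u.1 - v.1)).1 (by
      rw [Preadditive.comp_sub, (isLift_iff_counit_comp_eq adj x y f _).1 u.2,
        (isLift_iff_counit_comp_eq adj x y f _).1 v.2, sub_self])).choose_spec
    change v.1 + t _ = u.1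
    rw [this]
    abel)
  vadd_vsub' a u := ht (by
    have h1 : adj.counit.app x.obj ≫ (u.1 + t a - u.1) = 0 := by
      rw [add_sub_cancel_left]
      exact (ht' (t a)).2 ⟨a, rfl⟩
    refine ((ht' (u.1 + t a - u.1)).1 h1).choose_spec.trans ?_
    abel)

include hT in
theorem exists_obstruction [∀ n : ℤ, (shiftFunctor T' n).Additive]
    {H₀ H₁ : Type*} [AddCommGroup H₀] [AddCommGroup H₁]
    (e₀ : (K ⟶ y.obj) ≃+ H₀) (e₁ : (K ⟶ y.obj⟦(1 : ℤ)⟧) ≃+ H₁) :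
    ∃ o : (X ⟶ Y) →+ H₁, (∀ f : X ⟶ Y, o f = 0 ↔ Nonempty (MapLift f x y)) ∧
      (Subsingleton (ShiftedHom X Y (-1 : ℤ)) → ∃ t : H₀ →+ (x.obj ⟶ y.obj),
        ∀ f : X ⟶ Y, o f = 0 → ∃ _ : AddTorsor H₀ (MapLift f x y),
          ∀ a (u : MapLift f x y), (a +ᵥ u).1 = u.1 + t a) := by
  let o : (X ⟶ Y) →+ H₁ := e₁.toAddMonoidHom.comp (((Preadditive.leftComp _ δ).comp
    (shiftFunctor T (1 : ℤ)).mapAddHom).comp (adjointOfLift adj x y))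
  have ho : ∀ f : X ⟶ Y, o f = 0 ↔ Nonempty (MapLift f x y) := fun f => by
    rw [nonempty_mapLift_iff adj x y hT]
    exact e₁.map_eq_zero_iff
  refine ⟨o, ho, fun h => ?_⟩
  -- Precomposition with `g : x ⟶ K` does not involve `f`, so one homomorphism serves all `f`.
  let t : H₀ →+ (x.obj ⟶ y.obj) := (Preadditive.leftComp _ g).comp e₀.symm.toAddMonoidHom
  have ht : Function.Injective t := (injective_iff_map_eq_zero t).2 fun a ha =>
    e₀.symm.map_eq_zero_iff.1 (comp_left_injective_of_subsingleton adj x y hT h _ ha)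
  have ht' : ∀ u, adj.counit.app x.obj ≫ u = 0 ↔ u ∈ t.range := fun u => by
    constructor
    · intro hu
      obtain ⟨b, hb⟩ := Triangle.yoneda_exact₂ _ hT u hu
      refine ⟨e₀ b, ?_⟩
      exact (congrArg (g ≫ ·) (e₀.symm_apply_apply b)).trans hb.symm
    · rintro ⟨a, rfl⟩
      have h0 : adj.counit.app x.obj ≫ g = 0 := comp_distTriang_mor_zero₁₂ _ hT
      change adj.counit.app x.obj ≫ g ≫ _ = 0
      rw [reassoc_of% h0, zero_comp]
  exact ⟨t, fun f hf => ⟨mapLiftAddTorsor adj x y t ht ht' f ((ho f).1 hf), fun _ _ => rfl⟩⟩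

end Obstruction

/-- Isomorphisms induce isomorphisms of the groups of morphisms. -/
def homCongrAddEquiv {T : Type*} [Category* T] [Preadditive T] {K L M N : T}
    (e : K ≅ L) (e' : M ≅ N) : (K ⟶ M) ≃+ (L ⟶ N) :=
  { Iso.homCongr e e' with
    map_add' := fun f g => by simp }

end DerivedLift

end

theorem mainTheorem5
    -- surjections `Rb → R → S` of coherent commutative rings with finitely generated kernels
    {Rb R S : Type*} [CommRing Rb] [CommRing R] [CommRing S]
    (hRb : IsCoherentRing Rb) (hR : IsCoherentRing R) (hS : IsCoherentRing S)
    (p : Rb →+* R) (q : R →+* S)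
    (hp : Function.Surjective p) (hq : Function.Surjective q)
    (hp' : (RingHom.ker p).FG) (hq' : (RingHom.ker q).FG)
    -- `I J = 0`, for the kernels `I` of `Rb → S` and `J` of `Rb → R`
    (hIJ : RingHom.ker (q.comp p) * RingHom.ker p = ⊥)
    -- flat linear abelian categories with enough injectives
    {Cb : Type*} [Category* Cb] [Abelian Cb] [Linear Rb Cb] [EnoughInjectives Cb]
    {C : Type*} [Category* C] [Abelian C] [Linear R C] [EnoughInjectives C]
    {C₀ : Type*} [Category* C₀] [Abelian C₀] [Linear S C₀] [EnoughInjectives C₀]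
    [HasDerivedCategory Cb] [HasDerivedCategory C] [HasDerivedCategory C₀]
    (hCb : IsFlatAbelian Rb Cb) (hC : IsFlatAbelian R C) (hC₀ : IsFlatAbelian S C₀)
    -- abelian deformations `C₀ → C → Cb` along `R → S` and `Rb → R`
    (ιb : C ⥤ Cb) (ι : C₀ ⥤ C) (hιb : IsDeformation p ιb) (hι : IsDeformation q ι)
    -- objects `X`, `Y` of `D^+(C)` with lifts `x`, `y` along `RHom_Rb(R, -)`
    (X Y : DerivedCategory.Plus C)
    (x : ObjLift (RHomS hιb hp hp') X) (y : ObjLift (RHomS hιb hp hp') Y) :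
    -- obstructions in `H^1 RHom_{C₀}(RHom_R(J, X), RHom_R(S, Y))`
    ∃ o : (X ⟶ Y) →+
        RHomCohomology ((RHomJ p hRb hp' hι hq hq').obj X) ((RHomS hι hq hq').obj Y) 1,
      (∀ f : X ⟶ Y, o f = 0 ↔ Nonempty (MapLift f x y)) ∧
      -- if `Ext^{-1}(X, Y) = 0`, then the sets of lifts are affine over `H^0`
      (Subsingleton (RHomCohomology X Y (-1)) →
        ∃ t : RHomCohomology ((RHomJ p hRb hp' hι hq hq').obj X)
            ((RHomS hι hq hq').obj Y) 0 →+ (x.obj ⟶ y.obj),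
          ∀ f : X ⟶ Y, o f = 0 →
            ∃ _ : AddTorsor (RHomCohomology ((RHomJ p hRb hp' hι hq hq').obj X)
                ((RHomS hι hq hq').obj Y) 0) (MapLift f x y),
              ∀ a (g : MapLift f x y), (a +ᵥ g).1 = g.1 + t a) := by
  have := hιb.additive
  have := hι.additive
  have := hιb.preservesFiniteLimits hp hp'
  have := hιb.preservesFiniteColimits hp hp'
  have := hι.preservesFiniteLimits hq hq'
  have := hι.preservesFiniteColimits hq hq'
  let adj := derivedPlusAdj (homSAdj hιb hp hp')
  let adj₀ := derivedPlusAdj (homSAdj hι hq hq')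
  -- The right adjoints inherit compatibility with shifts from the left adjoints.
  let _ := adj.rightAdjointCommShift ℤ
  let _ := adj₀.rightAdjointCommShift ℤ
  have := adj.right_adjoint_additive
  obtain ⟨K, g, δ, hT⟩ := Pretriangulated.distinguished_cocone_triangle (adj.counit.app x.obj)
  obtain ⟨k⟩ := nonempty_obj₃_iso_RHomJ hιb hι hp hq hp' hq' hRb hIJ hCb x.obj g δ hT
  -- Replace `K` by the image of `RHom_R(J, F x)`, apply both adjunctions, then replace `F x` by
  -- `X`.
  let e (W : DerivedCategory.Plus Cb) : (K ⟶ W) ≃+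
      ((RHomJ p hRb hp' hι hq hq').obj X ⟶
        (RHomS hι hq hq').obj ((RHomS hιb hp hp').obj W)) :=
    (homCongrAddEquiv k (Iso.refl W)).trans ((adj.homAddEquiv _ _).trans
      ((adj₀.homAddEquiv _ _).trans (homCongrAddEquiv
        ((RHomJ p hRb hp' hι hq hq').mapIso x.iso.symm) (Iso.refl _))))
  -- For `W = y` and `W = y[1]` it remains to replace `F y` by `Y` and, in degree one, to move the
  -- shift outside both derived functors.
  exact exists_obstruction adj x y hT
    ((e y.obj).trans (homCongrAddEquiv (Iso.refl _)
      ((RHomS hι hq hq').mapIso y.iso.symm ≪≫ ((shiftFunctorZero _ ℤ).app _).symm)))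
    ((e (y.obj⟦(1 : ℤ)⟧)).trans (homCongrAddEquiv (Iso.refl _)
      ((RHomS hι hq hq').mapIso (((RHomS hιb hp hp').commShiftIso (1 : ℤ)).app y.obj) ≪≫
        ((RHomS hι hq hq').commShiftIso (1 : ℤ)).app _ ≪≫
          (shiftFunctor _ (1 : ℤ)).mapIso ((RHomS hι hq hq').mapIso y.iso.symm))))
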